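/- Let $(\Omega,\Sigma,\mu)$ be a localisable measure space with $\mu\neq 0$; that is, $\mu$ is semi-finite (every $E\in\Sigma$ with $\mu(E)=\infty$ contains some $F\in\Sigma$ with $0<\mu(F)<\infty$) and for every family $\mathcal E\subseteq\Sigma$ there is $H\in\Sigma$ such that $\mu(E\setminus H)=0$ for all $E\in\mathcal E$, and $\mu(H\setminus G)=0$ for every $G\in\Sigma$ with $\mu(E\setminus G)=0$ for all $E\in\mathcal E$. Let $B$ denote the closed unit ball of the real Banach space $L_1(\mu)$. A slice of $B$ is a set $S(B,x^*,\alpha)=\{x\in B: x^*(x)>\sup x^*(B)-\alpha\}$ with $x^*\in L_1(\mu)^*$ and $\alpha>0$. A point $f\in B$ is an almost preserved extreme point (APEP) of $B$ if every relatively weakly open subset of $B$ containing $f$ contains a non-empty slice of $B$; it is a denting point of $B$ if for every $\varepsilon>0$ there is a slice of $B$ of diameter less than $\varepsilon$ containing $f$. An atom of $\mu$ is a set $A\in\Sigma$ with $\mu(A)>0$ such that $\mu(B')=0$ for every measurable $B'\subseteq A$ with $\mu(B')<\mu(A)$. Then, for every $f\in B$, the following are equivalent: 1. $f$ is an APEP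 of $B$. 2. $f$ is a denting point of $B$. 3. $f=\frac{\chi_A}{\mu(A)}$ or $f=-\frac{\chi_A}{\mu(A)}$ ($\mu$-almost everywhere) for some atom $A$ of $\mu$. In particular, if moreover $\mu$ is atomless (has no atoms), then $B$ has no APEP. -/

import Mathlib

namespace AlmostPreserved

open MeasureTheory

section Geometry

variable {X : Type*} [NormedAddCommGroup X] [NormedSpace ℝ X]

/-- The open slice `S(C, x*, α) = {x ∈ C : x*(x) > sup x*(C) - α}` of a bounded set `C`. -/
def slice (C : Set X) (xstar : StrongDual ℝ X) (α : ℝ) : Set X :=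
  {x | x ∈ C ∧ sSup (xstar '' C) - α < xstar x}

/-- `W` is relatively weakly open in `C`: it is the trace on `C` of a set which is open for the
weak topology of `X`. -/
def IsRelWeaklyOpen (C W : Set X) : Prop :=
  ∃ U : Set (WeakSpace ℝ X), IsOpen U ∧ W = C ∩ toWeakSpace ℝ X ⁻¹' U

/-- `x₀` is an almost preserved extreme point (APEP) of the bounded closed convex set `C`:
every relatively weakly open subset of `C` containing `x₀` contains a non-empty slice of `C`
(which need not contain `x₀`). -/
def IsAPEP (C : Set X) (x₀ : X) : Prop :=
  x₀ ∈ C ∧ ∀ W : Set X, IsRelWeaklyOpen C W → x₀ ∈ W →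
    ∃ (xstar : StrongDual ℝ X) (α : ℝ), 0 < α ∧
      (slice C xstar α).Nonempty ∧ slice C xstar α ⊆ W

/-- `x₀` is a denting point of the bounded set `C`: it lies in slices of `C` of arbitrarily
small diameter. -/
def IsDentingPoint (C : Set X) (x₀ : X) : Prop :=
  x₀ ∈ C ∧ ∀ ε : ℝ, 0 < ε → ∃ (xstar : StrongDual ℝ X) (α : ℝ), 0 < α ∧
    x₀ ∈ slice C xstar α ∧ Metric.diam (slice C xstar α) < ε

end Geometry

section Measures

variable {Ω : Type*} [MeasurableSpace Ω]

/-- Localisable measures: `μ` is semi-finite, and every family of measurable sets has an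
essential supremum. -/
structure IsLocalisable (μ : Measure Ω) : Prop where
  semifinite : ∀ E : Set Ω, MeasurableSet E → μ E = ⊤ →
    ∃ F : Set Ω, F ⊆ E ∧ MeasurableSet F ∧ 0 < μ F ∧ μ F < ⊤
  exists_essSup : ∀ 𝓔 : Set (Set Ω), (∀ E ∈ 𝓔, MeasurableSet E) →
    ∃ H : Set Ω, MeasurableSet H ∧ (∀ E ∈ 𝓔, μ (E \ H) = 0) ∧
      ∀ G : Set Ω, MeasurableSet G → (∀ E ∈ 𝓔, μ (E \ G) = 0) → μ (H \ G) = 0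

/-- `A` is an atom of `μ`: a measurable set with `μ A > 0` each of whose measurable subsets of
strictly smaller measure is null. (For semi-finite `μ`, atoms have finite measure.) -/
def IsAtomOf (μ : Measure Ω) (A : Set Ω) : Prop :=
  MeasurableSet A ∧ 0 < μ A ∧
    ∀ B : Set Ω, MeasurableSet B → B ⊆ A → μ B < μ A → μ B = 0

/-- `μ` is atomless. -/
def IsAtomless (μ : Measure Ω) : Prop := ∀ A : Set Ω, ¬ IsAtomOf μ A

end Measures

end AlmostPreserved

namespace AlmostPreserved

open MeasureTheory

/-! ### Slices of the unit ball of a normed space -/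

section Geometry

variable {X : Type*} [NormedAddCommGroup X] [NormedSpace ℝ X]

/-! The `L¹` norm is additive over disjoint pieces. If `g = a + b` with `‖a‖ + ‖b‖ = ‖g‖`, a
functional with `t * ‖g‖ < φ g` satisfies the same inequality at `a` or at `b`, so a slice
containing a normalised `g` contains a normalised piece of it. Hence every weak neighbourhood of an
APEP contains normalised pieces of any prescribed kind (`IsAPEP.exists_normalized_mem`).

Cutting by sign gives `|∫ f| ≥ 1`; cutting along `E` and its complement shows that `f` vanishes on
one of them. So the support of `f` is an atom, `f` is constant on it, and the norm fixes the
constant up to sign. Conversely, on an atom every `g` is constant, so the integral over the atom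
controls `‖g - f‖`, which makes `f` denting. Denting points are always APEPs. -/

lemma bddAbove_image_closedBall (φ : StrongDual ℝ X) :
    BddAbove (φ '' Metric.closedBall (0 : X) 1) := by
  refine ⟨‖φ‖, ?_⟩
  rintro _ ⟨x, hx, rfl⟩
  calc φ x ≤ ‖φ x‖ := le_abs_self _
    _ ≤ ‖φ‖ * ‖x‖ := φ.le_opNorm x
    _ ≤ ‖φ‖ * 1 := by gcongr; simpa using hx
    _ = ‖φ‖ := mul_one _

lemma isOpen_preimage_toWeakSpace_symm (φ : StrongDual ℝ X) {V : Set ℝ} (hV : IsOpen V) :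
    IsOpen {x : WeakSpace ℝ X | φ ((toWeakSpace ℝ X).symm x) ∈ V} :=
  hV.preimage (WeakBilin.eval_continuous (topDualPairing ℝ X).flip φ)

/-- A non-empty slice of the unit ball contains a normalised summand of every norm-additive
decomposition, provided that every vector can be so decomposed. -/
lemma IsAPEP.exists_normalized_mem [Nontrivial X] {f : X}
    (h : IsAPEP (Metric.closedBall (0 : X) 1) f) {U : Set (WeakSpace ℝ X)} (hU : IsOpen U)
    (hf : toWeakSpace ℝ X f ∈ U) {P : X → Prop}
    (hdec : ∀ g : X, ∃ a b, g = a + b ∧ ‖a‖ + ‖b‖ = ‖g‖ ∧ P a ∧ P b) :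
    ∃ p, p ≠ 0 ∧ P p ∧ toWeakSpace ℝ X (‖p‖⁻¹ • p) ∈ U := by
  obtain ⟨φ, α, hα, ⟨x, hxB, hx⟩, hsub⟩ := h.2 _ ⟨U, hU, rfl⟩ ⟨h.1, hf⟩
  set t := sSup (φ '' Metric.closedBall (0 : X) 1) - α with ht
  -- The homogeneous form of the slice inequality survives normalisation. If `t < 0`, the point of
  -- the slice may violate it, but any nonzero vector satisfies it up to sign.
  have hg : ∃ g : X, t * ‖g‖ < φ g := by
    rcases le_or_gt 0 t with h0 | h0
    · refine ⟨x, lt_of_le_of_lt ?_ hx⟩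
      exact mul_le_of_le_one_right h0 (by simpa using hxB)
    · obtain ⟨g, hg⟩ := exists_ne (0 : X)
      have hneg : t * ‖g‖ < 0 := mul_neg_of_neg_of_pos h0 (norm_pos_iff.2 hg)
      rcases le_total 0 (φ g) with h1 | h1
      · exact ⟨g, by linarith⟩
      · exact ⟨-g, by rw [norm_neg, map_neg]; linarith⟩
  obtain ⟨g, hg⟩ := hg
  obtain ⟨a, b, hab, hnorm, ha, hb⟩ := hdec g
  have key : ∃ p, P p ∧ t * ‖p‖ < φ p := by
    by_contra! hcon
    have h1 := hcon a ha
    have h2 := hcon b hb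
    rw [← hnorm, hab, map_add] at hg
    linarith
  obtain ⟨p, hp, hlt⟩ := key
  have hp0 : p ≠ 0 := by
    rintro rfl
    simp at hlt
  have hpos := norm_pos_iff.2 hp0
  have hmem : ‖p‖⁻¹ • p ∈ slice (Metric.closedBall (0 : X) 1) φ α := by
    refine ⟨?_, ?_⟩
    · simp [norm_smul, hpos.ne']
    · rw [map_smul, smul_eq_mul, ← ht, inv_mul_eq_div, lt_div_iff₀ hpos]
      exact hlt
  exact ⟨p, hp0, hp, (hsub hmem).2⟩

/-- Weakly open sets are norm open, so a small enough slice around `f` fits inside. -/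
lemma IsDentingPoint.isAPEP {f : X} (h : IsDentingPoint (Metric.closedBall (0 : X) 1) f) :
    IsAPEP (Metric.closedBall (0 : X) 1) f := by
  refine ⟨h.1, ?_⟩
  rintro W ⟨U, hU, rfl⟩ ⟨-, hfU⟩
  have hopen : IsOpen (toWeakSpace ℝ X ⁻¹' U) := hU.preimage (toWeakSpaceCLM ℝ X).continuous
  obtain ⟨ε, hε, hball⟩ := Metric.isOpen_iff.1 hopen f hfU
  obtain ⟨φ, α, hα, hf, hd⟩ := h.2 ε hε
  refine ⟨φ, α, hα, ⟨f, hf⟩, fun x hx => ⟨hx.1, hball ?_⟩⟩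
  have hb : Bornology.IsBounded (slice (Metric.closedBall (0 : X) 1) φ α) :=
    Metric.isBounded_closedBall.subset fun _ hy => hy.1
  exact (Metric.dist_le_diam_of_mem hb hx hf).trans_lt hd

/-- A point of the unit ball is denting as soon as some functional of norm one on the ball
controls the distance to it. -/
lemma isDentingPoint_of_dist_le {f : X} (hf : f ∈ Metric.closedBall (0 : X) 1)
    {φ : StrongDual ℝ X} (hφ : ∀ g, φ g ≤ ‖g‖) (hφf : φ f = 1) (C : ℝ)
    (hdist : ∀ g ∈ Metric.closedBall (0 : X) 1, dist g f ≤ C * (1 - φ g)) :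
    IsDentingPoint (Metric.closedBall (0 : X) 1) f := by
  refine ⟨hf, fun ε hε => ?_⟩
  have hle : sSup (φ '' Metric.closedBall (0 : X) 1) ≤ 1 := by
    refine csSup_le ⟨_, f, hf, rfl⟩ ?_
    rintro _ ⟨g, hg, rfl⟩
    exact (hφ g).trans (by simpa using hg)
  have hge : 1 ≤ sSup (φ '' Metric.closedBall (0 : X) 1) :=
    le_csSup (bddAbove_image_closedBall φ) ⟨f, hf, hφf⟩
  have hC : 0 < |C| + 1 := by positivity
  -- Puts the slice in a ball of radius `ε / 4`, of diameter at most `ε / 2`; `|C| + 1` is positive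
  -- whatever the sign of `C`.
  set α := ε / (4 * (|C| + 1)) with hα
  have hα0 : 0 < α := by positivity
  have hαε : (|C| + 1) * α = ε / 4 := by rw [hα]; field_simp
  refine ⟨φ, α, hα0, ⟨hf, by linarith⟩, ?_⟩
  have hsub : slice (Metric.closedBall (0 : X) 1) φ α ⊆ Metric.closedBall f (ε / 4) := by
    rintro g ⟨hgB, hg⟩
    have h0 : 0 ≤ 1 - φ g := by
      have := hφ g
      have : ‖g‖ ≤ 1 := by simpa using hgB
      linarith
    have h1 : 1 - φ g ≤ α := by linarith
    calc dist g f ≤ C * (1 - φ g) := hdist g hgB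
      _ ≤ (|C| + 1) * (1 - φ g) := by
        gcongr
        linarith [le_abs_self C]
      _ ≤ (|C| + 1) * α := by gcongr
      _ = ε / 4 := hαε
  calc Metric.diam _ ≤ Metric.diam (Metric.closedBall f (ε / 4)) :=
        Metric.diam_mono hsub Metric.isBounded_closedBall
    _ ≤ 2 * (ε / 4) := Metric.diam_closedBall (by positivity)
    _ < ε := by linarith

end Geometry

/-! ### Atoms and the unit ball of `L¹` -/

section Measures

variable {Ω : Type*} [MeasurableSpace Ω] {μ : Measure Ω}

lemma IsLocalisable.measure_lt_top_of_isAtomOf (hμ : IsLocalisable μ) {A : Set Ω}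
    (hA : IsAtomOf μ A) : μ A < ⊤ := by
  by_contra! h
  obtain ⟨F, hFA, hF, h0, h1⟩ := hμ.semifinite A hA.1 (top_le_iff.1 h)
  exact h0.ne' (hA.2.2 F hF hFA (h1.trans_le h))

lemma IsLocalisable.nontrivial_L1 (hμ : IsLocalisable μ) (hμ0 : μ ≠ 0) :
    Nontrivial (Lp ℝ 1 μ) := by
  obtain ⟨F, hF, h0, h1⟩ : ∃ F, MeasurableSet F ∧ 0 < μ F ∧ μ F < ⊤ := by
    rcases eq_or_ne (μ Set.univ) ⊤ with h | h
    · obtain ⟨F, -, hF⟩ := hμ.semifinite Set.univ .univ h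
      exact ⟨F, hF⟩
    · exact ⟨Set.univ, .univ, (Measure.measure_univ_pos).2 hμ0, h.lt_top⟩
  refine ⟨indicatorConstLp 1 hF h1.ne (1 : ℝ), 0, ?_⟩
  rw [← norm_pos_iff, norm_indicatorConstLp one_ne_zero ENNReal.one_ne_top]
  have : 0 < μ.real F := ENNReal.toReal_pos h0.ne' h1.ne
  simp [this]

/-- Measurable functions are almost everywhere constant on atoms of finite measure. -/
lemma IsAtomOf.ae_eq_const {A : Set Ω} (hA : IsAtomOf μ A) (hfin : μ A < ⊤) {g : Ω → ℝ}
    (hg : Measurable g) : ∃ c, g =ᵐ[μ.restrict A] fun _ => c := by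
  -- On an atom each preimage is null or conull, and countably many measurable sets separate the
  -- points of `ℝ`.
  refine Filter.exists_eventuallyEq_const_of_forall_separating MeasurableSet fun S hS => ?_
  have hm : MeasurableSet (g ⁻¹' S) := hg hS
  rcases lt_or_ge (μ (A ∩ g ⁻¹' S)) (μ A) with h | h
  · right
    have h0 := hA.2.2 _ (hA.1.inter hm) Set.inter_subset_left h
    rw [ae_iff, Measure.restrict_apply' hA.1]
    refine measure_mono_null ?_ h0
    rintro x ⟨h1, h2⟩
    exact ⟨h2, not_not.1 h1⟩
  · left
    have h1 := measure_inter_add_sdiff A hm (μ := μ)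
    rw [ae_iff, Measure.restrict_apply' hA.1]
    have h0 : μ (A \ g ⁻¹' S) = 0 := by
      have h2 : μ (A ∩ g ⁻¹' S) = μ A := le_antisymm (measure_mono Set.inter_subset_left) h
      rw [h2] at h1
      exact (ENNReal.add_right_inj hfin.ne).1 (h1.trans (add_zero _).symm)
    refine measure_mono_null ?_ h0
    rintro x ⟨h1, h2⟩
    exact ⟨h2, h1⟩

/-- Integration over `E`, as a functional on `L¹`. -/
noncomputable def setIntegralCLM (μ : Measure Ω) (E : Set Ω) : StrongDual ℝ (Lp ℝ 1 μ) where
  toFun g := ∫ x in E, g x ∂μ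
  map_add' g h := by
    rw [← integral_add (L1.integrable_coeFn g).integrableOn (L1.integrable_coeFn h).integrableOn]
    exact integral_congr_ae (ae_restrict_of_ae (Lp.coeFn_add g h))
  map_smul' c g := by
    rw [RingHom.id_apply, ← integral_smul]
    exact integral_congr_ae (ae_restrict_of_ae (Lp.coeFn_smul c g))
  cont := continuous_setIntegral E

lemma setIntegralCLM_apply (E : Set Ω) (g : Lp ℝ 1 μ) :
    setIntegralCLM μ E g = ∫ x in E, g x ∂μ := rfl

lemma abs_setIntegralCLM_le (E : Set Ω) (g : Lp ℝ 1 μ) : |setIntegralCLM μ E g| ≤ ‖g‖ := by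
  rw [setIntegralCLM_apply, L1.norm_eq_integral_norm]
  exact (norm_integral_le_integral_norm _).trans
    (setIntegral_le_integral (L1.integrable_coeFn g).norm (.of_forall fun _ => norm_nonneg _))

lemma exists_indicator_decomposition (g : Lp ℝ 1 μ) {E : Set Ω} (hE : MeasurableSet E) :
    ∃ a b : Lp ℝ 1 μ, g = a + b ∧ ‖a‖ + ‖b‖ = ‖g‖ ∧
      (a : Ω → ℝ) =ᵐ[μ] E.indicator g ∧ (b : Ω → ℝ) =ᵐ[μ] Eᶜ.indicator g := by
  have hg := L1.integrable_coeFn g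
  have ha := hg.indicator hE
  have hb := hg.indicator hE.compl
  refine ⟨ha.toL1 _, hb.toL1 _, ?_, ?_, ha.coeFn_toL1, hb.coeFn_toL1⟩
  · refine Lp.ext ?_
    filter_upwards [Lp.coeFn_add (ha.toL1 _) (hb.toL1 _), ha.coeFn_toL1, hb.coeFn_toL1]
      with x h1 h2 h3
    rw [h1, Pi.add_apply, h2, h3]
    exact (Set.indicator_self_add_compl_apply E g x).symm
  · simp only [L1.norm_eq_integral_norm]
    rw [integral_congr_ae (ha.coeFn_toL1.mono fun _ h => congrArg norm h),
      integral_congr_ae (hb.coeFn_toL1.mono fun _ h => congrArg norm h)]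
    simp only [norm_indicator_eq_indicator_norm]
    rw [integral_indicator hE, integral_indicator hE.compl, integral_add_compl hE hg.norm]

/-- `|∫ p| < 1` is a weakly open condition, which a normalised function of constant sign cannot
satisfy. -/
lemma IsAPEP.one_le_abs_integral [Nontrivial (Lp ℝ 1 μ)] {f : Lp ℝ 1 μ}
    (h : IsAPEP (Metric.closedBall (0 : Lp ℝ 1 μ) 1) f) : 1 ≤ |∫ x, f x ∂μ| := by
  by_contra! hlt
  have happ (g : Lp ℝ 1 μ) : setIntegralCLM μ Set.univ g = ∫ x, g x ∂μ := by
    rw [setIntegralCLM_apply, setIntegral_univ]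
  obtain ⟨p, hp0, hp, hmem⟩ := h.exists_normalized_mem
    (isOpen_preimage_toWeakSpace_symm (setIntegralCLM μ Set.univ)
      (isOpen_lt continuous_abs continuous_const : IsOpen {r : ℝ | |r| < 1}))
    (by simpa [happ] using hlt) (P := fun p => |∫ x, p x ∂μ| = ‖p‖) fun g => by
      have hm : MeasurableSet {x | 0 ≤ g x} :=
        measurableSet_le measurable_const (Lp.stronglyMeasurable g).measurable
      obtain ⟨a, b, hab, hn, ha, hb⟩ := exists_indicator_decomposition g hm
      refine ⟨a, b, hab, hn, ?_, ?_⟩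
      · have h0 : 0 ≤ᵐ[μ] a := by
          filter_upwards [ha] with x hx
          rw [hx]
          exact Set.indicator_nonneg (fun _ h => h) x
        rw [L1.norm_eq_integral_norm, abs_of_nonneg (integral_nonneg_of_ae h0)]
        refine integral_congr_ae ?_
        filter_upwards [h0] with x hx using (Real.norm_of_nonneg hx).symm
      · have h0 : b ≤ᵐ[μ] 0 := by
          filter_upwards [hb] with x hx
          rw [hx]
          exact Set.indicator_nonpos (fun _ h => (not_le.1 h).le) x
        rw [L1.norm_eq_integral_norm, abs_of_nonpos (integral_nonpos_of_ae h0), ← integral_neg]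
        refine integral_congr_ae ?_
        filter_upwards [h0] with x hx using (Real.norm_of_nonpos hx).symm
  have hpos := norm_pos_iff.2 hp0
  have : |‖p‖⁻¹ * ∫ x, p x ∂μ| < 1 := by
    rw [← happ, ← smul_eq_mul, ← map_smul]
    simpa using hmem
  rw [abs_mul, hp, abs_of_pos (inv_pos.2 hpos), inv_mul_cancel₀ hpos.ne'] at this
  exact lt_irrefl _ this

lemma LpToLpRestrictCLM_eq_zero_iff (g : Lp ℝ 1 μ) (E : Set Ω) :
    LpToLpRestrictCLM Ω ℝ ℝ μ 1 E g = 0 ↔ (g : Ω → ℝ) =ᵐ[μ.restrict E] 0 := by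
  rw [Lp.eq_zero_iff_ae_eq_zero]
  have := LpToLpRestrictCLM_coeFn (p := 1) ℝ E g
  exact ⟨fun h => this.symm.trans h, fun h => this.trans h⟩

/-- If both restrictions of `f` were nonzero, Hahn–Banach functionals would detect this on a weak
neighbourhood, which therefore misses all pieces living on one side of the cut. -/
lemma IsAPEP.ae_eq_zero_restrict_or_compl [Nontrivial (Lp ℝ 1 μ)] {f : Lp ℝ 1 μ}
    (h : IsAPEP (Metric.closedBall (0 : Lp ℝ 1 μ) 1) f) {E : Set Ω} (hE : MeasurableSet E) :
    (f : Ω → ℝ) =ᵐ[μ.restrict E] 0 ∨ (f : Ω → ℝ) =ᵐ[μ.restrict Eᶜ] 0 := by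
  rw [← LpToLpRestrictCLM_eq_zero_iff, ← LpToLpRestrictCLM_eq_zero_iff]
  by_contra! hcon
  obtain ⟨φ, -, hφ⟩ := exists_dual_vector ℝ _ (norm_ne_zero_iff.2 hcon.1)
  obtain ⟨ψ, -, hψ⟩ := exists_dual_vector ℝ _ (norm_ne_zero_iff.2 hcon.2)
  obtain ⟨p, hp0, hp, hmem⟩ := h.exists_normalized_mem
    ((isOpen_preimage_toWeakSpace_symm (φ.comp (LpToLpRestrictCLM Ω ℝ ℝ μ 1 E))
      isOpen_ne (V := {r | r ≠ 0})).inter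
      (isOpen_preimage_toWeakSpace_symm (ψ.comp (LpToLpRestrictCLM Ω ℝ ℝ μ 1 Eᶜ))
      isOpen_ne (V := {r | r ≠ 0})))
    (by simpa [hφ, hψ] using hcon)
    (P := fun p => LpToLpRestrictCLM Ω ℝ ℝ μ 1 E p = 0 ∨ LpToLpRestrictCLM Ω ℝ ℝ μ 1 Eᶜ p = 0)
    fun g => by
      obtain ⟨a, b, hab, hn, ha, hb⟩ := exists_indicator_decomposition g hE
      refine ⟨a, b, hab, hn, .inr ?_, .inl ?_⟩
      · rw [LpToLpRestrictCLM_eq_zero_iff]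
        exact Filter.EventuallyEq.trans (ae_restrict_of_ae ha) (indicator_ae_eq_restrict_compl hE)
      · rw [LpToLpRestrictCLM_eq_zero_iff]
        refine Filter.EventuallyEq.trans (ae_restrict_of_ae hb) ?_
        simpa using indicator_ae_eq_restrict_compl (f := (g : Ω → ℝ)) (μ := μ) hE.compl
  rcases hp with hp | hp
  · exact hmem.1 (by simp [hp])
  · exact hmem.2 (by simp [hp])

lemma integral_indicator_const_of_ae_eq {f : Ω → ℝ} {A : Set Ω} (hA : MeasurableSet A) {c : ℝ}
    (hf : f =ᵐ[μ] A.indicator fun _ => c) : ∫ x, f x ∂μ = μ.real A * c := by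
  rw [integral_congr_ae hf, integral_indicator hA, setIntegral_const, smul_eq_mul]

lemma IsAPEP.exists_atom (hμ : IsLocalisable μ) [Nontrivial (Lp ℝ 1 μ)] {f : Lp ℝ 1 μ}
    (h : IsAPEP (Metric.closedBall (0 : Lp ℝ 1 μ) 1) f) :
    ∃ A : Set Ω, IsAtomOf μ A ∧
      ((f : Ω → ℝ) =ᵐ[μ] A.indicator (fun _ => 1 / μ.real A) ∨
        (f : Ω → ℝ) =ᵐ[μ] fun ω => -(A.indicator (fun _ => 1 / μ.real A) ω)) := by
  have hfm : Measurable f := (Lp.stronglyMeasurable f).measurable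
  have hint := h.one_le_abs_integral
  set A : Set Ω := {x | f x ≠ 0} with hAdef
  have hAm : MeasurableSet A := hfm (measurableSet_singleton (0 : ℝ)).compl
  have hnull {E : Set Ω} (hE : MeasurableSet E) (hz : (f : Ω → ℝ) =ᵐ[μ.restrict E] 0) :
      μ (A ∩ E) = 0 := by
    have := ae_iff.1 hz
    rwa [Measure.restrict_apply' hE] at this
  have hsplit {E : Set Ω} (hE : MeasurableSet E) : μ (A ∩ E) = 0 ∨ μ (A \ E) = 0 :=
    (h.ae_eq_zero_restrict_or_compl hE).imp (hnull hE) (hnull hE.compl)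
  have hatom : IsAtomOf μ A := by
    refine ⟨hAm, ?_, fun B hB hBA hlt => ?_⟩
    · rw [pos_iff_ne_zero]
      intro h0
      have hz : (f : Ω → ℝ) =ᵐ[μ] 0 := h0
      rw [integral_congr_ae hz] at hint
      simp at hint
      linarith
    -- Either `f` vanishes on `B`, making `B` null, or it vanishes off `B`, forcing `μ B = μ A`.
    · rcases hsplit hB with h0 | h0
      · rwa [Set.inter_eq_right.2 hBA] at h0
      · have := measure_inter_add_sdiff A hB (μ := μ)
        rw [Set.inter_eq_right.2 hBA, h0, add_zero] at this
        exact absurd this hlt.ne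
  have hfin := hμ.measure_lt_top_of_isAtomOf hatom
  have hpos : 0 < μ.real A := ENNReal.toReal_pos hatom.2.1.ne' hfin.ne
  obtain ⟨c, hc⟩ := hatom.ae_eq_const hfin hfm
  have hfc : (f : Ω → ℝ) =ᵐ[μ] A.indicator fun _ => c := by
    filter_upwards [(ae_restrict_iff' hAm).1 hc] with x hx
    by_cases hxA : x ∈ A
    · rw [Set.indicator_of_mem hxA, hx hxA]
    · rw [Set.indicator_of_notMem hxA]
      exact not_not.1 hxA
  have habs : |∫ x, f x ∂μ| = 1 := by
    refine le_antisymm ?_ hint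
    have h1 := abs_setIntegralCLM_le Set.univ f
    rw [setIntegralCLM_apply, setIntegral_univ] at h1
    exact h1.trans (by simpa using h.1)
  rw [integral_indicator_const_of_ae_eq hAm hfc] at habs
  refine ⟨A, hatom, ?_⟩
  rcases eq_or_eq_neg_of_abs_eq habs with h1 | h1
  · left
    rwa [eq_div_of_mul_eq hpos.ne' ((mul_comm _ _).trans h1)] at hfc
  · right
    rw [eq_div_of_mul_eq hpos.ne' ((mul_comm _ _).trans h1)] at hfc
    filter_upwards [hfc] with x hx
    rw [hx, Set.indicator_apply, Set.indicator_apply]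
    split_ifs <;> ring

/-- Take `φ g = s * ∫ g` over `A`. The distance from `g` to `f` is `1 - φ g` on `A`, plus the mass
of `g` off `A`, at most `1 - φ g` since `‖g‖ ≤ 1`; hence the constant `2`. -/
lemma isDentingPoint_of_atom {A : Set Ω} (hA : IsAtomOf μ A) (hfin : μ A < ⊤) {s : ℝ}
    (hs : |s| = 1) {f : Lp ℝ 1 μ} (hf : f ∈ Metric.closedBall (0 : Lp ℝ 1 μ) 1)
    (hfA : (f : Ω → ℝ) =ᵐ[μ] A.indicator fun _ => s / μ.real A) :
    IsDentingPoint (Metric.closedBall (0 : Lp ℝ 1 μ) 1) f := by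
  have hpos : 0 < μ.real A := ENNReal.toReal_pos hA.2.1.ne' hfin.ne
  have hss : s * s = 1 := by rw [← abs_mul_abs_self, hs, one_mul]
  have habs (r : ℝ) : |s * r| = |r| := by rw [abs_mul, hs, one_mul]
  refine isDentingPoint_of_dist_le hf (φ := s • setIntegralCLM μ A) (C := 2) (fun g => ?_) ?_
    fun g hg => ?_
  · exact (le_abs_self _).trans ((habs _).trans_le (abs_setIntegralCLM_le A g))
  · have : ∫ x in A, f x ∂μ = s := by
      rw [setIntegral_congr_ae (g := fun _ => s / μ.real A) hA.1, setIntegral_const, smul_eq_mul,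
        mul_div_cancel₀ _ hpos.ne']
      filter_upwards [hfA] with x hx hxA
      rw [hx, Set.indicator_of_mem hxA]
    change s * ∫ x in A, f x ∂μ = 1
    rw [this, hss]
  · change dist g f ≤ 2 * (1 - s * ∫ x in A, g x ∂μ)
    have hgi := L1.integrable_coeFn g
    have hfi := L1.integrable_coeFn f
    have hg1 : ‖g‖ ≤ 1 := by simpa using hg
    obtain ⟨k, hk⟩ := hA.ae_eq_const hfin (Lp.stronglyMeasurable g).measurable
    have hI : ∫ x in A, g x ∂μ = μ.real A * k := by
      rw [integral_congr_ae hk, setIntegral_const, smul_eq_mul]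
    have hN : ∫ x in A, ‖g x‖ ∂μ = μ.real A * |k| := by
      rw [integral_congr_ae (hk.mono fun _ h => congrArg norm h), setIntegral_const,
        smul_eq_mul, Real.norm_eq_abs]
    have hk' := (ae_restrict_iff' hA.1).1 hk
    have hin : ∫ x in A, ‖g x - f x‖ ∂μ = |μ.real A * k - s| := by
      rw [setIntegral_congr_ae (g := fun _ => |k - s / μ.real A|) hA.1, setIntegral_const,
        smul_eq_mul, ← abs_of_pos hpos, ← abs_mul, abs_of_pos hpos, mul_sub,
        mul_div_cancel₀ _ hpos.ne']
      filter_upwards [hfA, hk'] with x hx hx' hxA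
      rw [hx, Set.indicator_of_mem hxA, hx' hxA, Real.norm_eq_abs]
    have hout : ∫ x in Aᶜ, ‖g x - f x‖ ∂μ = ∫ x in Aᶜ, ‖g x‖ ∂μ := by
      refine setIntegral_congr_ae hA.1.compl ?_
      filter_upwards [hfA] with x hx hxA
      rw [hx, Set.indicator_of_notMem hxA, sub_zero]
    have hnorm := L1.norm_eq_integral_norm g
    rw [← integral_add_compl hA.1 hgi.norm, hN] at hnorm
    have hdist : dist g f = |μ.real A * k - s| + ∫ x in Aᶜ, ‖g x‖ ∂μ := by
      rw [L1.dist_eq_integral_dist]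
      simp only [dist_eq_norm]
      rw [← hin, ← hout]
      exact (integral_add_compl hA.1 (hgi.sub hfi).norm).symm
    have hnn : 0 ≤ ∫ x in Aᶜ, ‖g x‖ ∂μ := integral_nonneg fun _ => norm_nonneg _
    have hk1 : s * (μ.real A * k) ≤ μ.real A * |k| := by
      calc s * (μ.real A * k) ≤ |s * (μ.real A * k)| := le_abs_self _
        _ = μ.real A * |k| := by rw [habs, abs_mul, abs_of_pos hpos]
    -- Multiplying by `s` preserves absolute values and turns `s` into `1`, which bounds `s *
    -- (μ.real A * k)` from above.
    have hk2 : |μ.real A * k - s| = 1 - s * (μ.real A * k) := by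
      rw [← habs, mul_sub, hss, abs_of_nonpos (by linarith)]
      ring
    rw [hdist, hI, hk2]
    linarith

end Measures

end AlmostPreserved

theorem mainTheorem8 {Ω : Type*} [MeasurableSpace Ω] (μ : MeasureTheory.Measure Ω)
    (hμ : AlmostPreserved.IsLocalisable μ) (hμ0 : μ ≠ 0) :
    (∀ f : MeasureTheory.Lp ℝ 1 μ, f ∈ Metric.closedBall (0 : MeasureTheory.Lp ℝ 1 μ) 1 →
      List.TFAE [
        AlmostPreserved.IsAPEP (Metric.closedBall (0 : MeasureTheory.Lp ℝ 1 μ) 1) f,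
        AlmostPreserved.IsDentingPoint (Metric.closedBall (0 : MeasureTheory.Lp ℝ 1 μ) 1) f,
        ∃ A : Set Ω, AlmostPreserved.IsAtomOf μ A ∧
          ((f : Ω → ℝ) =ᵐ[μ] A.indicator (fun _ => 1 / μ.real A) ∨
            (f : Ω → ℝ) =ᵐ[μ] fun ω => -(A.indicator (fun _ => 1 / μ.real A) ω))]) ∧
    (AlmostPreserved.IsAtomless μ →
      ∀ f : MeasureTheory.Lp ℝ 1 μ,
        ¬ AlmostPreserved.IsAPEP (Metric.closedBall (0 : MeasureTheory.Lp ℝ 1 μ) 1) f) := by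
  have := hμ.nontrivial_L1 hμ0
  refine ⟨fun f hf => ?_, fun hat f hf => ?_⟩
  · tfae_have 1 → 3 := fun h => h.exists_atom hμ
    tfae_have 3 → 2 := by
      rintro ⟨A, hA, h | h⟩
      · exact AlmostPreserved.isDentingPoint_of_atom hA (hμ.measure_lt_top_of_isAtomOf hA)
          (s := 1) (by simp) hf h
      · refine AlmostPreserved.isDentingPoint_of_atom hA (hμ.measure_lt_top_of_isAtomOf hA)
          (s := -1) (by simp) hf ?_
        filter_upwards [h] with x hx
        rw [hx, neg_div]
        exact (congrFun (Set.indicator_neg A fun _ => 1 / μ.real A) x).symm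
    tfae_have 2 → 1 := fun h => h.isAPEP
    tfae_finish
  · obtain ⟨A, hA, -⟩ := hf.exists_atom hμ
    exact hat A hA
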